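/- Let $J_0$ and $I_0$ be the Bessel function and the modified Bessel function of the first kind of order $0$. Let $\kappa>0$ and put $$F_0(\alpha)=\frac{\kappa}{\alpha}\,J_0(\alpha)\,I_0'\Bigl(\frac{\kappa}{\alpha}\Bigr)-\alpha\, I_0\Bigl(\frac{\kappa}{\alpha}\Bigr)J_0'(\alpha)\qquad(\alpha>0).$$ Then $F_0$ has a smallest positive root $\alpha_{0,1}$, and the linear system $$c\,J_0(\alpha_{0,1})+d\,I_0\Bigl(\frac{\kappa}{\alpha_{0,1}}\Bigr)=0,\qquad c\,\alpha_{0,1}J_0'(\alpha_{0,1})+d\,\frac{\kappa}{\alpha_{0,1}}\,I_0'\Bigl(\frac{\kappa}{\alpha_{0,1}}\Bigr)=0$$ has a nontrivial real solution $(c,d)\neq(0,0)$. For every such solution, the function $$R_{0,1}(r)=c\,J_0(\alpha_{0,1}r)+d\,I_0\Bigl(\frac{\kappa}{\alpha_{0,1}}\,r\Bigr)$$ is such that $|R_{0,1}|$ is positive on $[0,1)$ and strictly decreasing on $[0,1]$. -/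

import Mathlib

/-- The `m`-th term of the power series of the modified Bessel function `I_k` at `x`. -/
noncomputable def besselITerm (k : ℕ) (x : ℝ) (m : ℕ) : ℝ :=
  (x / 2) ^ (2 * m + k) / ((m.factorial : ℝ) * ((m + k).factorial : ℝ))

theorem summable_besselITerm (k : ℕ) (x : ℝ) :
    Summable fun m : ℕ => |besselITerm k x m| := by
  have h := (Real.summable_pow_div_factorial (|x / 2| ^ 2)).mul_left (|x / 2| ^ k)
  refine Summable.of_nonneg_of_le (fun m => abs_nonneg _) (fun m => ?_) h
  have h1 : (1 : ℝ) ≤ ((m + k).factorial : ℝ) := by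
    exact_mod_cast Nat.succ_le_of_lt (Nat.factorial_pos _)
  have h2 : (0 : ℝ) < (m.factorial : ℝ) := by exact_mod_cast Nat.factorial_pos _
  have h3 : |besselITerm k x m|
      = |x / 2| ^ (2 * m + k) / ((m.factorial : ℝ) * ((m + k).factorial : ℝ)) := by
    simp [besselITerm, abs_div, abs_mul, abs_pow]
  rw [h3, pow_add, pow_mul, mul_comm ((|x / 2| ^ 2) ^ m), mul_div_assoc]
  refine mul_le_mul_of_nonneg_left ?_ (by positivity)
  exact div_le_div_of_nonneg_left (by positivity) h2 (le_mul_of_one_le_right h2.le h1)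

/-- The modified Bessel function of the first kind `I_k`, of order `k`, on the real line:
`I_k(x) = ∑ (x/2)^(2m+k) / (m! (m+k)!)`. -/
noncomputable def besselI (k : ℕ) (x : ℝ) : ℝ :=
  ∑' m : ℕ, besselITerm k x m

/-- The Bessel function of the first kind `J_k`, of order `k`, on the real line:
`J_k(x) = ∑ (-1)^m (x/2)^(2m+k) / (m! (m+k)!)`. -/
noncomputable def besselJ (k : ℕ) (x : ℝ) : ℝ :=
  ∑' m : ℕ, (-1) ^ m * besselITerm k x m

theorem summable_besselJ (k : ℕ) (x : ℝ) :
    Summable fun m : ℕ => (-1) ^ m * besselITerm k x m := by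
  refine Summable.of_abs ?_
  simpa [abs_mul, abs_pow] using summable_besselITerm k x

/-- The function
`F_k(α) = (κ/α) J_k(α) I_k'(κ/α) - α I_k(κ/α) J_k'(α)`, meant for `α > 0`. -/
noncomputable def charFun (k : ℕ) (κ α : ℝ) : ℝ :=
  κ / α * besselJ k α * deriv (besselI k) (κ / α)
    - α * besselI k (κ / α) * deriv (besselJ k) α

/-- The set of positive roots of `F_k`. Its increasing enumeration is
`α_{k,1} < α_{k,2} < …`; in particular `α_{k,1}` is its least element. -/
def charRoots (k : ℕ) (κ : ℝ) : Set ℝ :=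
  {α : ℝ | 0 < α ∧ charFun k κ α = 0}

/-- `(c, d)` is a nontrivial solution of the linear system that expresses the boundary
conditions `R(1) = R'(1) = 0` for `R(r) = c J_k(α r) + d I_k((κ/α) r)`. -/
def IsBoundaryCoeff (k : ℕ) (κ α c d : ℝ) : Prop :=
  (c, d) ≠ (0, 0) ∧
  c * besselJ k α + d * besselI k (κ / α) = 0 ∧
  c * α * deriv (besselJ k) α + d * (κ / α) * deriv (besselI k) (κ / α) = 0

/-- The radial function `R(r) = c J_k(α r) + d I_k((κ/α) r)`. -/
noncomputable def radialFun (k : ℕ) (κ α c d r : ℝ) : ℝ :=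
  c * besselJ k (α * r) + d * besselI k (κ / α * r)

/-! Everything rests on J₀' = -J₁, I₀' = I₁, (xJ₁)' = xJ₀, (xI₁)' = xI₀. They turn F₀(α) into
J₀(α)·(κ/α)I₁(κ/α) + I₀(κ/α)·αJ₁(α).

Let j be the first positive zero of J₁. On [0, j], J₀ decreases from 1 to a negative value and
vanishes at some z < j. F₀ is positive on (0, z] and negative at j, so its least root α lies in (z,
j). Hence J₀(α) < 0, and J₁ > 0 on (0, α) (`exists_isLeast_charRoots_zero`).

As J₀(α) < 0 < I₀(κ/α), c and d have the same sign, without loss of generality positive. Then T(r) =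
rR'(r) vanishes at 0 and 1, and T' = rS with S strictly increasing, so T < 0 in between
(`strictAntiOn_besselJ_add_besselI`). Thus R decreases strictly to R(1) = 0. -/

/-! ### Termwise differentiation of the series -/

/-- The common generating series `∑ s ^ m (x/2)^(2m+k) / (m! (m+k)!)` of the Bessel functions:
`s = -1` gives `J_k` and `s = 1` gives `I_k`. -/
noncomputable def besselSeries (s : ℝ) (k : ℕ) (x : ℝ) : ℝ :=
  ∑' m : ℕ, s ^ m * besselITerm k x m

theorem besselJ_eq_besselSeries (k : ℕ) : besselJ k = besselSeries (-1) k := rfl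

theorem besselI_eq_besselSeries (k : ℕ) : besselI k = besselSeries 1 k := by
  funext x
  simp [besselI, besselSeries]

theorem abs_besselITerm_le {k : ℕ} {x R : ℝ} (h : |x| ≤ R) (m : ℕ) :
    |besselITerm k x m| ≤ besselITerm k R m := by
  have h3 : |besselITerm k x m| = besselITerm k |x| m := by
    simp [besselITerm, abs_div, abs_mul, abs_pow]
  rw [h3]
  unfold besselITerm
  gcongr

theorem summable_besselITerm' (k : ℕ) (x : ℝ) : Summable fun m : ℕ => besselITerm k x m :=
  (summable_besselITerm k x).of_abs

theorem abs_pow_mul_le {s : ℝ} (hs : |s| = 1) (m : ℕ) (y : ℝ) : |s ^ m * y| = |y| := by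
  rw [abs_mul, abs_pow, hs, one_pow, one_mul]

theorem summable_besselSeries {s : ℝ} (hs : |s| = 1) (k : ℕ) (x : ℝ) :
    Summable fun m : ℕ => s ^ m * besselITerm k x m := by
  refine Summable.of_abs ?_
  simpa only [abs_pow_mul_le hs] using summable_besselITerm k x

theorem hasDerivAt_besselITerm_zero_zero (x : ℝ) :
    HasDerivAt (fun y => besselITerm 0 y 0) 0 x := by
  simpa [besselITerm] using hasDerivAt_const x (1 : ℝ)

theorem hasDerivAt_besselITerm_zero_succ (m : ℕ) (x : ℝ) :
    HasDerivAt (fun y => besselITerm 0 y (m + 1)) (besselITerm 1 x m) x := by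
  unfold besselITerm
  have h := ((((hasDerivAt_id x).div_const 2).pow (2 * (m + 1) + 0)).div_const
    (((m + 1).factorial : ℝ) * ((m + 1 + 0).factorial : ℝ)))
  refine h.congr_deriv ?_
  have e : 2 * (m + 1) + 0 - 1 = 2 * m + 1 := by omega
  rw [e, add_zero, Nat.factorial_succ]
  have : (m.factorial : ℝ) ≠ 0 := by positivity
  have : (m : ℝ) + 1 ≠ 0 := by positivity
  push_cast
  simp only [id]
  field_simp

theorem hasDerivAt_mul_besselITerm_one (m : ℕ) (x : ℝ) :
    HasDerivAt (fun y => y * besselITerm 1 y m) (x * besselITerm 0 x m) x := by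
  unfold besselITerm
  have h := (hasDerivAt_id x).mul ((((hasDerivAt_id x).div_const 2).pow (2 * m + 1)).div_const
    ((m.factorial : ℝ) * ((m + 1).factorial : ℝ)))
  refine h.congr_deriv ?_
  have e : 2 * m + 1 - 1 = 2 * m := by omega
  rw [e, add_zero, Nat.factorial_succ]
  have : (m.factorial : ℝ) ≠ 0 := by positivity
  have : (m : ℝ) + 1 ≠ 0 := by positivity
  push_cast
  simp only [id, Pi.pow_apply, pow_succ]
  field_simp
  ring_nf

theorem abs_lt_of_mem_ball {x R : ℝ} (h : x ∈ Metric.ball (0 : ℝ) R) : |x| < R := by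
  simpa [Real.dist_eq] using h

theorem hasDerivAt_besselSeries_zero {s : ℝ} (hs : |s| = 1) (x : ℝ) :
    HasDerivAt (besselSeries s 0) (s * besselSeries s 1 x) x := by
  set R := |x| + 1 with hR
  have hx : x ∈ Metric.ball (0 : ℝ) R := by simp [hR]
  have h := hasDerivAt_tsum_of_isPreconnected (𝕜 := ℝ)
    (g := fun (m : ℕ) y => s ^ (m + 1) * besselITerm 0 y (m + 1))
    (g' := fun (m : ℕ) y => s ^ (m + 1) * besselITerm 1 y m)
    (u := fun m : ℕ => besselITerm 1 R m) (t := Metric.ball (0 : ℝ) R)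
    (summable_besselITerm' 1 R) Metric.isOpen_ball (convex_ball (0 : ℝ) R).isPreconnected
    (fun m y _ => (hasDerivAt_besselITerm_zero_succ m y).const_mul _)
    (fun m y hy => by
      rw [Real.norm_eq_abs, abs_pow_mul_le hs]
      exact abs_besselITerm_le (abs_lt_of_mem_ball hy).le m)
    hx ((summable_nat_add_iff 1).2 (summable_besselSeries hs 0 x)) hx
  -- The constant zeroth term is split off: term `m + 1` of order 0 differentiates to term `m` of
  -- order 1.
  have e : besselSeries s 0
      = fun y => s ^ 0 * besselITerm 0 y 0 + ∑' m, s ^ (m + 1) * besselITerm 0 y (m + 1) := by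
    funext y
    exact (summable_besselSeries hs 0 y).tsum_eq_zero_add
  rw [e]
  refine (((hasDerivAt_besselITerm_zero_zero x).const_mul (s ^ 0)).add h).congr_deriv ?_
  simp only [besselSeries, ← tsum_mul_left, mul_zero, zero_add]
  exact tsum_congr fun m => by ring

theorem hasDerivAt_mul_besselSeries_one {s : ℝ} (hs : |s| = 1) (x : ℝ) :
    HasDerivAt (fun y => y * besselSeries s 1 y) (x * besselSeries s 0 x) x := by
  set R := |x| + 1 with hR
  have hx : x ∈ Metric.ball (0 : ℝ) R := by simp [hR]
  have h := hasDerivAt_tsum_of_isPreconnected (𝕜 := ℝ)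
    (g := fun (m : ℕ) y => s ^ m * (y * besselITerm 1 y m))
    (g' := fun (m : ℕ) y => s ^ m * (y * besselITerm 0 y m))
    (u := fun m : ℕ => R * besselITerm 0 R m) (t := Metric.ball (0 : ℝ) R)
    ((summable_besselITerm' 0 R).mul_left R) Metric.isOpen_ball
    (convex_ball (0 : ℝ) R).isPreconnected
    (fun m y _ => (hasDerivAt_mul_besselITerm_one m y).const_mul _)
    (fun m y hy => by
      have hy' := (abs_lt_of_mem_ball hy).le
      rw [Real.norm_eq_abs, abs_pow_mul_le hs, abs_mul]
      exact mul_le_mul hy' (abs_besselITerm_le hy' m) (abs_nonneg _)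
        ((abs_nonneg y).trans hy'))
    hx (((summable_besselSeries hs 1 x).mul_left x).congr fun m => by ring) hx
  have e (k : ℕ) (y : ℝ) : ∑' m, s ^ m * (y * besselITerm k y m) = y * besselSeries s k y := by
    rw [besselSeries, ← tsum_mul_left]
    exact tsum_congr fun m => by ring
  simpa only [e] using h

theorem hasDerivAt_besselJ_zero (x : ℝ) : HasDerivAt (besselJ 0) (-besselJ 1 x) x := by
  simpa [besselJ_eq_besselSeries] using hasDerivAt_besselSeries_zero (s := -1) (by simp) x

theorem hasDerivAt_besselI_zero (x : ℝ) : HasDerivAt (besselI 0) (besselI 1 x) x := by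
  simpa [besselI_eq_besselSeries] using hasDerivAt_besselSeries_zero (s := 1) (by simp) x

theorem hasDerivAt_mul_besselJ_one (x : ℝ) :
    HasDerivAt (fun y => y * besselJ 1 y) (x * besselJ 0 x) x :=
  hasDerivAt_mul_besselSeries_one (s := -1) (by simp) x

theorem hasDerivAt_mul_besselI_one (x : ℝ) :
    HasDerivAt (fun y => y * besselI 1 y) (x * besselI 0 x) x := by
  simpa only [besselI_eq_besselSeries] using hasDerivAt_mul_besselSeries_one (s := 1) (by simp) x

theorem continuous_besselJ_zero : Continuous (besselJ 0) :=
  continuous_iff_continuousAt.2 fun x => (hasDerivAt_besselJ_zero x).continuousAt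

theorem continuous_besselI_zero : Continuous (besselI 0) :=
  continuous_iff_continuousAt.2 fun x => (hasDerivAt_besselI_zero x).continuousAt

theorem continuous_mul_besselJ_one : Continuous fun x => x * besselJ 1 x :=
  continuous_iff_continuousAt.2 fun x => (hasDerivAt_mul_besselJ_one x).continuousAt

theorem continuous_mul_besselI_one : Continuous fun x => x * besselI 1 x :=
  continuous_iff_continuousAt.2 fun x => (hasDerivAt_mul_besselI_one x).continuousAt

theorem besselI_pos (k : ℕ) {x : ℝ} (hx : 0 < x) : 0 < besselI k x := by
  have h (m : ℕ) : 0 < besselITerm k x m := by unfold besselITerm; positivity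
  exact (summable_besselITerm' k x).tsum_pos (fun m => (h m).le) 0 (h 0)

/-! ### Signs of J₀ and J₁ up to the first positive zero of J₁ -/

theorem besselJ_zero_zero : besselJ 0 0 = 1 := by
  rw [besselJ, tsum_eq_single 0]
  · simp [besselITerm]
  · intro m hm
    simp [besselITerm, hm]

/-- The moduli 2, 4, 8/3, 8/9, 8/45, … decrease only from the second on, so the leading 2 is split
off. Four terms of the remaining alternating series give the bound 2 - 92/45 < 0. -/
theorem besselJ_one_four_neg : besselJ 1 4 < 0 := by
  have hs := summable_besselJ 1 4
  have hs' := (summable_nat_add_iff 1).2 hs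
  have hanti : Antitone fun m => besselITerm 1 4 (m + 1) := by
    refine antitone_nat_of_succ_le fun m => ?_
    have h : besselITerm 1 4 (m + 1 + 1)
        = besselITerm 1 4 (m + 1) * (4 / (((m : ℝ) + 2) * (m + 3))) := by
      unfold besselITerm
      rw [Nat.factorial_succ (m + 1 + 1), Nat.factorial_succ (m + 1)]
      have : ((m + 1).factorial : ℝ) ≠ 0 := by positivity
      have : (m : ℝ) + 2 ≠ 0 := by positivity
      have : (m : ℝ) + 3 ≠ 0 := by positivity
      push_cast
      have e : (m : ℝ) + 1 + 1 = m + 2 := by ring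
      simp only [e, pow_succ, Nat.mul_add]
      field_simp
      ring_nf
    have hp : 0 ≤ besselITerm 1 4 (m + 1) := by unfold besselITerm; positivity
    rw [h]
    refine mul_le_of_le_one_right hp ?_
    have hm : (0 : ℝ) ≤ m := by positivity
    rw [div_le_one (by positivity)]
    nlinarith
  have hsum : HasSum (fun m => (-1) ^ m * besselITerm 1 4 (m + 1))
      (-∑' m, (-1) ^ (m + 1) * besselITerm 1 4 (m + 1)) := by
    have e : (fun m => (-1) ^ m * besselITerm 1 4 (m + 1))
        = fun m => -((-1) ^ (m + 1) * besselITerm 1 4 (m + 1)) := by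
      funext m
      ring
    exact e ▸ hs'.hasSum.neg
  have hle := hanti.alternating_series_le_tendsto hsum.tendsto_sum_nat 2
  rw [besselJ, hs.tsum_eq_zero_add]
  norm_num [Finset.sum_range_succ, besselITerm, Nat.factorial] at hle ⊢
  linarith

/-- There is a first positive zero of `J₁`, and `J₀` is negative there. -/
theorem exists_first_zero_besselJ_one :
    ∃ j : ℝ, 0 < j ∧ besselJ 1 j = 0 ∧ (∀ x ∈ Set.Ioo 0 j, 0 < besselJ 1 x) ∧
      besselJ 0 j < 0 := by
  obtain ⟨ε, hε, hJ⟩ : ∃ ε > 0, ∀ x, |x| < ε → 0 < besselJ 0 x := by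
    have h : ∀ᶠ x in nhds (0 : ℝ), 0 < besselJ 0 x :=
      continuous_besselJ_zero.continuousAt.eventually_const_lt (by simp [besselJ_zero_zero])
    simpa [Metric.eventually_nhds_iff] using h
  -- xJ₁ vanishes at 0 and has derivative xJ₀.
  have key {b : ℝ} (h : ∀ x ∈ Set.Ioo 0 b, 0 < besselJ 0 x) :
      ∀ x ∈ Set.Ioc 0 b, 0 < besselJ 1 x := by
    have hmono : StrictMonoOn (fun x => x * besselJ 1 x) (Set.Icc 0 b) := by
      refine strictMonoOn_of_deriv_pos (convex_Icc 0 b) continuous_mul_besselJ_one.continuousOn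
        fun x hx => ?_
      rw [interior_Icc] at hx
      rw [(hasDerivAt_mul_besselJ_one x).deriv]
      exact mul_pos hx.1 (h x hx)
    intro x hx
    have h0 := hmono ⟨le_rfl, hx.1.le.trans hx.2⟩ ⟨hx.1.le, hx.2⟩ hx.1
    simp only [zero_mul] at h0
    exact pos_of_mul_pos_right h0 hx.1.le
  have hε1 : ∀ x ∈ Set.Ioc 0 (ε / 2), 0 < besselJ 1 x :=
    key fun x hx => hJ x (by rw [abs_of_pos hx.1]; linarith [hx.2])
  set δ := ε / 2 with hδ
  have hδ0 : 0 < δ := by positivity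
  have hδ4 : δ < 4 := by
    by_contra! hle
    exact (hε1 4 ⟨by norm_num, hle⟩).not_gt besselJ_one_four_neg
  have hivt {b : ℝ} (hb : δ ≤ b) (hb' : b * besselJ 1 b ≤ 0) :
      ∃ x ∈ Set.Icc δ b, x * besselJ 1 x = 0 :=
    intermediate_value_Icc' hb continuous_mul_besselJ_one.continuousOn
      ⟨hb', (mul_pos hδ0 (hε1 δ ⟨hδ0, le_rfl⟩)).le⟩
  -- Starting at δ excludes the trivial zero of xJ₁ at 0, so the zero set is compact with a positive
  -- minimum.
  obtain ⟨j, ⟨hj, hj0⟩, hjmin⟩ :=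
    (isCompact_Icc.inter_right (isClosed_singleton.preimage continuous_mul_besselJ_one)
      : IsCompact (Set.Icc δ 4 ∩ (fun x => x * besselJ 1 x) ⁻¹' {0})).exists_isLeast
      (by
        obtain ⟨x, hx, hx0⟩ := hivt hδ4.le (by nlinarith [besselJ_one_four_neg])
        exact ⟨x, hx, hx0⟩)
  have hjpos : 0 < j := hδ0.trans_le hj.1
  have hj1 : besselJ 1 j = 0 := by simpa [hjpos.ne'] using hj0
  have hpos : ∀ x ∈ Set.Ioo 0 j, 0 < besselJ 1 x := by
    intro x hx
    rcases le_total x δ with h | h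
    · exact hε1 x ⟨hx.1, h⟩
    · by_contra! hneg
      obtain ⟨y, hy, hy0⟩ := hivt h (mul_nonpos_of_nonneg_of_nonpos hx.1.le hneg)
      exact (hjmin ⟨⟨hy.1, hy.2.trans (hx.2.le.trans hj.2)⟩, hy0⟩).not_gt
        (hy.2.trans_lt hx.2)
  refine ⟨j, hjpos, hj1, hpos, ?_⟩
  -- If J₀(j) ≥ 0, then J₀ > 0 on (0, j) by monotonicity, and `key` gives J₁(j) > 0.
  by_contra! hneg
  have hanti : StrictAntiOn (besselJ 0) (Set.Icc 0 j) := by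
    refine strictAntiOn_of_deriv_neg (convex_Icc 0 j) continuous_besselJ_zero.continuousOn
      fun x hx => ?_
    rw [interior_Icc] at hx
    rw [(hasDerivAt_besselJ_zero x).deriv]
    exact neg_neg_of_pos (hpos x hx)
  exact (key (fun x hx => hneg.trans_lt
    (hanti ⟨hx.1.le, hx.2.le⟩ ⟨hjpos.le, le_rfl⟩ hx.2)) j ⟨hjpos, le_rfl⟩).ne' hj1

/-! ### The least positive root of F₀ -/

theorem charFun_zero_eq (κ α : ℝ) :
    charFun 0 κ α
      = besselJ 0 α * (κ / α * besselI 1 (κ / α)) + besselI 0 (κ / α) * (α * besselJ 1 α) := by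
  rw [charFun, (hasDerivAt_besselI_zero _).deriv, (hasDerivAt_besselJ_zero _).deriv]
  ring

theorem continuousOn_charFun_zero (κ : ℝ) : ContinuousOn (charFun 0 κ) (Set.Ioi 0) := by
  have hd : ContinuousOn (fun α : ℝ => κ / α) (Set.Ioi 0) :=
    continuousOn_const.div continuousOn_id fun x hx => (Set.mem_Ioi.1 hx).ne'
  have h1 := continuous_mul_besselI_one.comp_continuousOn hd
  have h2 := continuous_besselI_zero.comp_continuousOn hd
  refine ((continuous_besselJ_zero.continuousOn.mul h1).add
    (h2.mul continuous_mul_besselJ_one.continuousOn)).congr fun α _ => ?_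
  exact charFun_zero_eq κ α

/-- The least positive root of `F₀` exists, `J₀` is negative there, and `J₁` is positive
up to that root. -/
theorem exists_isLeast_charRoots_zero {κ : ℝ} (hκ : 0 < κ) :
    ∃ α : ℝ, IsLeast (charRoots 0 κ) α ∧ besselJ 0 α < 0 ∧
      ∀ x ∈ Set.Ioo 0 α, 0 < besselJ 1 x := by
  obtain ⟨j, hj, hj1, hpos, hjneg⟩ := exists_first_zero_besselJ_one
  obtain ⟨z, hz, hz0⟩ : ∃ z ∈ Set.Icc 0 j, besselJ 0 z = 0 :=
    intermediate_value_Icc' hj.le continuous_besselJ_zero.continuousOn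
      ⟨hjneg.le, by simp [besselJ_zero_zero]⟩
  have hzpos : 0 < z := hz.1.lt_of_ne fun h => by
    rw [← h, besselJ_zero_zero] at hz0
    exact one_ne_zero hz0
  have hzj : z < j := hz.2.lt_of_ne fun h => hjneg.ne (h ▸ hz0)
  have hI (k : ℕ) {x : ℝ} (hx : 0 < x) : 0 < besselI k (κ / x) := besselI_pos k (div_pos hκ hx)
  have hF {x : ℝ} (hx : 0 < x) (hxj : x < j) (hJ : 0 ≤ besselJ 0 x) : 0 < charFun 0 κ x := by
    rw [charFun_zero_eq]
    exact add_pos_of_nonneg_of_pos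
      (mul_nonneg hJ (mul_pos (div_pos hκ hx) (hI 1 hx)).le)
      (mul_pos (hI 0 hx) (mul_pos hx (hpos x ⟨hx, hxj⟩)))
  have hFj : charFun 0 κ j < 0 := by
    rw [charFun_zero_eq, hj1, mul_zero, mul_zero, add_zero]
    exact mul_neg_of_neg_of_pos hjneg (mul_pos (div_pos hκ hj) (hI 1 hj))
  have hanti : StrictAntiOn (besselJ 0) (Set.Icc 0 j) := by
    refine strictAntiOn_of_deriv_neg (convex_Icc 0 j) continuous_besselJ_zero.continuousOn
      fun x hx => ?_
    rw [interior_Icc] at hx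
    rw [(hasDerivAt_besselJ_zero x).deriv]
    exact neg_neg_of_pos (hpos x hx)
  have hcont : ContinuousOn (charFun 0 κ) (Set.Icc z j) :=
    (continuousOn_charFun_zero κ).mono fun x hx => hzpos.trans_le hx.1
  -- By `hF` there is no root in (0, z], so the minimum over the compact [z, j] is the global one.
  obtain ⟨α, ⟨hα, hα0⟩, hmin⟩ :=
    (isCompact_Icc.of_isClosed_subset
      (hcont.preimage_isClosed_of_isClosed isClosed_Icc isClosed_singleton)
      Set.inter_subset_left : IsCompact (Set.Icc z j ∩ charFun 0 κ ⁻¹' {0})).exists_isLeast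
      (by
        obtain ⟨x, hx, hx0⟩ := intermediate_value_Icc' hzj.le hcont
          ⟨hFj.le, (hF hzpos hzj hz0.ge).le⟩
        exact ⟨x, hx, hx0⟩)
  have hαpos : 0 < α := hzpos.trans_le hα.1
  refine ⟨α, ⟨⟨hαpos, hα0⟩, fun x hx => ?_⟩, ?_, fun x hx => hpos x ⟨hx.1, hx.2.trans_le hα.2⟩⟩
  · by_contra! hlt
    have hxj : x < j := hlt.trans_le hα.2
    rcases le_total z x with h | h
    · exact (hmin ⟨⟨h, hxj.le⟩, hx.2⟩).not_gt hlt
    · refine (hF hx.1 hxj ?_).ne' hx.2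
      rw [← hz0]
      exact hanti.antitoneOn ⟨hx.1.le, hxj.le⟩ ⟨hz.1, hz.2⟩ h
  · have hne : α ≠ j := fun h => hFj.ne (h ▸ hα0)
    by_contra! hneg
    exact (hF hαpos (hα.2.lt_of_ne hne) hneg).ne' hα0

/-! ### Monotonicity of the radial function -/

/-- A positive combination of `J₀(a r)` and `I₀(b r)` whose derivative vanishes at `1` is strictly
decreasing on `[0, 1]`, provided that `J₁` is positive on `(0, a)`. -/
theorem strictAntiOn_besselJ_add_besselI {a b c d : ℝ} (ha : 0 < a) (hb : 0 < b) (hc : 0 < c)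
    (hd : 0 < d) (hpos : ∀ x ∈ Set.Ioo 0 a, 0 < besselJ 1 x)
    (h1 : d * (b * besselI 1 b) - c * (a * besselJ 1 a) = 0) :
    StrictAntiOn (fun r => c * besselJ 0 (a * r) + d * besselI 0 (b * r)) (Set.Icc 0 1) := by
  have hlin (e r : ℝ) : HasDerivAt (fun r => e * r) e r := by
    simpa using (hasDerivAt_id r).const_mul e
  have hR (r : ℝ) : HasDerivAt (fun r => c * besselJ 0 (a * r) + d * besselI 0 (b * r))
      (c * (-besselJ 1 (a * r) * a) + d * (besselI 1 (b * r) * b)) r :=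
    (((hasDerivAt_besselJ_zero _).comp r (hlin a r)).const_mul c).add
      (((hasDerivAt_besselI_zero _).comp r (hlin b r)).const_mul d)
  -- T(r) = rR'(r); the factor r makes the derivative rS(r), free of J₁ and I₁.
  set T : ℝ → ℝ := fun r =>
    d * (b * r * besselI 1 (b * r)) - c * (a * r * besselJ 1 (a * r)) with hT
  set S : ℝ → ℝ := fun r => d * b ^ 2 * besselI 0 (b * r) - c * a ^ 2 * besselJ 0 (a * r) with hS
  have hTd (r : ℝ) : HasDerivAt T (r * S r) r := by
    have h := (((hasDerivAt_mul_besselI_one _).comp r (hlin b r)).const_mul d).sub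
      (((hasDerivAt_mul_besselJ_one _).comp r (hlin a r)).const_mul c)
    refine h.congr_deriv ?_
    simp only [hS]
    ring
  have hSd (r : ℝ) : HasDerivAt S
      (d * b ^ 2 * (besselI 1 (b * r) * b) - c * a ^ 2 * (-besselJ 1 (a * r) * a)) r :=
    (((hasDerivAt_besselI_zero _).comp r (hlin b r)).const_mul (d * b ^ 2)).sub
      (((hasDerivAt_besselJ_zero _).comp r (hlin a r)).const_mul (c * a ^ 2))
  have hJ1 {r : ℝ} (hr : r ∈ Set.Ioo (0 : ℝ) 1) : 0 < besselJ 1 (a * r) :=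
    hpos _ ⟨mul_pos ha hr.1, by nlinarith [hr.2]⟩
  have hSmono : StrictMonoOn S (Set.Icc 0 1) := by
    refine strictMonoOn_of_deriv_pos (convex_Icc 0 1)
      (fun r _ => (hSd r).continuousAt.continuousWithinAt) fun r hr => ?_
    rw [interior_Icc] at hr
    rw [(hSd r).deriv]
    have hi := besselI_pos 1 (mul_pos hb hr.1)
    have hj := hJ1 hr
    have e1 : 0 < d * b ^ 2 * (besselI 1 (b * r) * b) := by positivity
    have e2 : 0 < c * a ^ 2 * (besselJ 1 (a * r) * a) := by positivity
    linarith
  have hTc : Continuous T := continuous_iff_continuousAt.2 fun r => (hTd r).continuousAt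
  have hT0 : T 0 = 0 := by simp [hT]
  have hT1 : T 1 = 0 := by simpa [hT] using h1
  -- If T(r) ≥ 0, the mean value theorem on [0, r] and [r, 1] gives x < y with S(x) ≥ 0 ≥ S(y),
  -- against the monotonicity of S.
  have hTneg {r : ℝ} (hr : r ∈ Set.Ioo (0 : ℝ) 1) : T r < 0 := by
    by_contra! hge
    obtain ⟨x, hx, hxe⟩ := exists_hasDerivAt_eq_slope T (fun r => r * S r) hr.1
      hTc.continuousOn fun x _ => hTd x
    obtain ⟨y, hy, hye⟩ := exists_hasDerivAt_eq_slope T (fun r => r * S r) hr.2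
      hTc.continuousOn fun x _ => hTd x
    rw [hT0, sub_zero, sub_zero] at hxe
    rw [hT1, zero_sub] at hye
    have hSx : 0 ≤ S x := nonneg_of_mul_nonneg_right (hxe ▸ div_nonneg hge hr.1.le) hx.1
    have hSy : S y ≤ 0 := by
      have hle : y * S y ≤ 0 :=
        hye ▸ div_nonpos_of_nonpos_of_nonneg (neg_nonpos.2 hge) (sub_nonneg.2 hr.2.le)
      exact nonpos_of_mul_nonpos_right hle (hr.1.trans hy.1)
    exact (hSx.trans_lt (hSmono ⟨hx.1.le, (hx.2.trans hr.2).le⟩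
      ⟨(hr.1.trans hy.1).le, hy.2.le⟩ (hx.2.trans hy.1))).not_ge hSy
  refine strictAntiOn_of_deriv_neg (convex_Icc 0 1)
    (fun r _ => (hR r).continuousAt.continuousWithinAt) fun r hr => ?_
  rw [interior_Icc] at hr
  rw [(hR r).deriv]
  have h := hTneg hr
  simp only [hT] at h
  refine neg_of_mul_neg_right (a := r) ?_ hr.1.le
  linarith

theorem isBoundaryCoeff_neg {k : ℕ} {κ α c d : ℝ} (h : IsBoundaryCoeff k κ α c d) :
    IsBoundaryCoeff k κ α (-c) (-d) := by
  obtain ⟨h0, h1, h2⟩ := h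
  refine ⟨fun h => h0 ?_, by linarith, by linarith⟩
  simpa using h

theorem radialFun_neg (k : ℕ) (κ α c d r : ℝ) :
    radialFun k κ α (-c) (-d) r = -radialFun k κ α c d r := by
  unfold radialFun
  ring

theorem theorem4p1 (κ : ℝ) (hκ : 0 < κ) :
    ∃ α : ℝ, IsLeast (charRoots 0 κ) α ∧
      (∃ c d : ℝ, IsBoundaryCoeff 0 κ α c d) ∧
      ∀ c d : ℝ, IsBoundaryCoeff 0 κ α c d →
        (∀ r ∈ Set.Ico (0 : ℝ) 1, 0 < |radialFun 0 κ α c d r|) ∧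
        StrictAntiOn (fun r : ℝ => |radialFun 0 κ α c d r|) (Set.Icc 0 1) := by
  obtain ⟨α, hleast, hJ, hpos⟩ := exists_isLeast_charRoots_zero hκ
  have hα : 0 < α := hleast.1.1
  have hI : 0 < besselI 0 (κ / α) := besselI_pos 0 (div_pos hκ hα)
  -- This pair solves the first equation identically; the second then reads F₀(α) = 0 up to sign.
  refine ⟨α, hleast, ⟨besselI 0 (κ / α), -besselJ 0 α, ?_, by ring, ?_⟩, ?_⟩
  · intro h
    exact hI.ne' (Prod.mk.inj h).1
  · have h := hleast.1.2
    rw [charFun] at h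
    linarith
  have main : ∀ c d : ℝ, 0 < c → IsBoundaryCoeff 0 κ α c d →
      (∀ r ∈ Set.Ico (0 : ℝ) 1, 0 < |radialFun 0 κ α c d r|) ∧
      StrictAntiOn (fun r : ℝ => |radialFun 0 κ α c d r|) (Set.Icc 0 1) := by
    rintro c d hc ⟨-, h1, h2⟩
    -- dI₀(κ/α) = -cJ₀(α) > 0, because J₀(α) < 0.
    have hd : 0 < d := by
      refine pos_of_mul_pos_left (b := besselI 0 (κ / α)) ?_ hI.le
      have := mul_neg_of_pos_of_neg hc hJ
      linarith
    rw [(hasDerivAt_besselI_zero _).deriv, (hasDerivAt_besselJ_zero _).deriv] at h2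
    have hanti : StrictAntiOn (radialFun 0 κ α c d) (Set.Icc 0 1) :=
      strictAntiOn_besselJ_add_besselI hα (div_pos hκ hα) hc hd hpos (by linarith)
    have hR1 : radialFun 0 κ α c d 1 = 0 := by simpa [radialFun] using h1
    have hRpos : ∀ r ∈ Set.Ico (0 : ℝ) 1, 0 < radialFun 0 κ α c d r := fun r hr =>
      hR1 ▸ hanti ⟨hr.1, hr.2.le⟩ ⟨zero_le_one, le_rfl⟩ hr.2
    have hRnn : ∀ r ∈ Set.Icc (0 : ℝ) 1, 0 ≤ radialFun 0 κ α c d r := fun r hr =>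
      hr.2.lt_or_eq.elim (fun h => (hRpos r ⟨hr.1, h⟩).le) fun h => (h ▸ hR1).ge
    exact ⟨fun r hr => abs_pos.2 (hRpos r hr).ne',
      hanti.congr fun r hr => (abs_of_nonneg (hRnn r hr)).symm⟩
  intro c d hcd
  rcases lt_trichotomy c 0 with hc | hc | hc
  · simpa only [radialFun_neg, abs_neg] using
      main (-c) (-d) (neg_pos.2 hc) (isBoundaryCoeff_neg hcd)
  · have hd : d = 0 := by simpa [hc, hI.ne'] using hcd.2.1
    exact absurd (by rw [hc, hd]) hcd.1
  · exact main c d hc hcd
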